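/- For a group $G$ with a finite generating set $S$, a real number $p\ge 1$ and $x\in\mathbb R$, the $\ell^p$-isoperimetric profile of $G$ is \[ j_{G,p}(x)=\sup\left\{\frac{\|f\|_p}{\|\nabla f\|_p} : f\colon G\to\mathbb R_+,\ f\neq 0,\ |\mathrm{supp} f|\le x\right\}\in[0,\infty],\qquad \|\nabla f\|_p^p=\sum_{g\in G,\,s\in S}|f(g)-f(gs)|^p, \] and $j_G=j_{G,1}$ (the value $\infty$ occurs only if $G$ is finite). For functions $u,v$ of a real variable with values in $[0,\infty]$, write $u(x)=O(v(x))$ if there is $K>0$ with $u(x)\le Kv(x)$ for all large enough $x$, and $u\preccurlyeq v$ if there is $C>0$ with $u(x)=O(v(Cx))$. A function $u$ satisfies Assumption $(\star)$ if $u(Cx)=O(u(x))$ for every $C>0$. The lampshuffler group of a group $H$ is $\mathrm{Shuf}(H)=\mathrm{FSym}(H)\rtimes H$, where $\mathrm{FSym}(H)$ is the group of finitely supported permutations of $H$ and $H$ acts by $(h\cdot\sigma)(x)=h\,\sigma(h^{-1}x)$. Theorem. Let $p\ge 1$ and let $H$ be an amenable group with a finite generating set such that the profile $j_{H,p}$ satisfies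 Assumption $(\star)$. Then $\mathrm{Shuf}(H)$ is finitely generated and, for every finite generating set of $\mathrm{Shuf}(H)$, \[ j_{H,p}\!\left(\frac{\ln x}{\ln\ln x}\right)\preccurlyeq j_{\mathrm{Shuf}(H),p}(x)\preccurlyeq j_H(\ln x). \] -/

import Mathlib

open scoped ENNReal NNReal

noncomputable section

/-- `FSym(X)`: the group of finitely supported permutations of `X`. -/
def finSym (X : Type*) : Subgroup (Equiv.Perm X) where
  carrier := {σ | {x | σ x ≠ x}.Finite}
  one_mem' := by simp
  mul_mem' := by
    intro σ τ hσ hτ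
    refine (Set.Finite.union hσ hτ).subset fun x hx => ?_
    by_contra h
    simp only [Set.mem_union, Set.mem_ofPred_eq, not_or, not_not] at h
    exact hx (by rw [Equiv.Perm.mul_apply, h.2, h.1])
  inv_mem' := by
    intro σ hσ
    refine Set.Finite.subset hσ fun x hx h => hx ?_
    rw [Equiv.Perm.inv_eq_iff_eq, h]

instance finSym_normal (X : Type*) : (finSym X).Normal where
  conj_mem := by
    intro σ hσ τ
    refine (Set.Finite.image τ hσ).subset fun x hx => ?_
    refine ⟨τ⁻¹ x, fun h => hx ?_, by simp⟩
    rw [Equiv.Perm.mul_apply, Equiv.Perm.mul_apply, h]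
    simp

/-- The action of `H` on `FSym(H)` by conjugation by left translations. -/
def shufAction (H : Type*) [Group H] : H →* MulAut (finSym H) :=
  (MulAut.conjNormal (H := finSym H)).comp (MulAction.toPermHom H H)

/-- The action is given by `(h · σ)(x) = h σ(h⁻¹ x)`. -/
theorem shufAction_apply {H : Type*} [Group H] (h : H) (σ : finSym H) (x : H) :
    (shufAction H h σ : Equiv.Perm H) x = h * (σ : Equiv.Perm H) (h⁻¹ * x) := by
  simp [shufAction, MulAut.conjNormal_apply, Equiv.Perm.mul_apply]

/-- The lampshuffler group `Shuf(H) = FSym(H) ⋊ H`. -/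
abbrev Lampshuffler (H : Type*) [Group H] : Type _ :=
  finSym H ⋊[shufAction H] H

/-- Amenability of a discrete group (Følner's condition): for every finite `E` and every `ε > 0`
there is a non-empty finite `A` with `|As \ A| ≤ ε |A|` for all `s ∈ E`. -/
def IsAmenableGroup (G : Type*) [Group G] : Prop :=
  ∀ (E : Finset G) (ε : ℝ), 0 < ε → ∃ A : Finset G, A.Nonempty ∧
    ∀ s ∈ E, (((((fun a => a * s) '' (A : Set G)) \ (A : Set G)).ncard : ℕ) : ℝ) ≤ ε * (A.card : ℝ)

/-- The `ℓ^p`-norm of a finitely supported function. -/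
def lpNormFin {G : Type*} (p : ℝ) (f : G →₀ ℝ≥0) : ℝ≥0∞ :=
  (∑' g : G, (f g : ℝ≥0∞) ^ p) ^ (1 / p)

/-- The `ℓ^p`-norm of the gradient, `‖∇f‖_p^p = ∑_{g ∈ G, s ∈ S} |f(g) - f(gs)|^p`. -/
def lpNormGrad {G : Type*} [Group G] (S : Finset G) (p : ℝ) (f : G →₀ ℝ≥0) : ℝ≥0∞ :=
  (∑' g : G, ∑ s ∈ S, ENNReal.ofReal |(f g : ℝ) - (f (g * s) : ℝ)| ^ p) ^ (1 / p)

/-- The `ℓ^p`-isoperimetric profile of `G` with respect to `S`, at a real argument `x`: the supremum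
of `‖f‖_p / ‖∇f‖_p` over the non-zero `f : G → ℝ₊` with `|supp f| ≤ x`. It is finite if `G` is
infinite and `S` generates `G`; on a finite group, constant functions have gradient `0`, and the
profile is `∞` for `x ≥ |G|`. -/
def isoProfile {G : Type*} [Group G] (S : Finset G) (p : ℝ) (x : ℝ) : ℝ≥0∞ :=
  ⨆ (f : G →₀ ℝ≥0) (_ : f ≠ 0) (_ : (f.support.card : ℝ) ≤ x), lpNormFin p f / lpNormGrad S p f

/-- `u(x) = O(v(x))` as `x → +∞`. -/
def IsBigOAtTop (u v : ℝ → ℝ≥0∞) : Prop :=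
  ∃ K : ℝ≥0, 0 < K ∧ ∀ᶠ x : ℝ in Filter.atTop, u x ≤ (K : ℝ≥0∞) * v x

/-- Domination `u ≼ v`: there is `C > 0` with `u(x) = O(v(Cx))`. -/
def Dominated (u v : ℝ → ℝ≥0∞) : Prop :=
  ∃ C : ℝ, 0 < C ∧ IsBigOAtTop u (fun x => v (C * x))

/-- Assumption `(⋆)`: `u(Cx) = O(u(x))` for every `C > 0`. -/
def AssumptionStar (u : ℝ → ℝ≥0∞) : Prop :=
  ∀ C : ℝ, 0 < C → IsBigOAtTop (fun x => u (C * x)) u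

end

/-! Replacing a generating set changes a profile only by a multiplicative constant, so each bound
may be proved with convenient moves: translations by `S` and transpositions of the current position
`h` with `h * b`.

Lower bound: spread a function `f` on `H` over all permutations supported in its support. This costs
a factor at most `n!` in support size, where `n` is the size of the support of `f`. A swap of two
points of the support preserves this set of permutations, so swaps add gradient only where `f`
already has some. As `n! * n ≤ n ^ n`, the support stays below `x` when `n ≤ log x / log (log x)`.

Upper bound: passing from `f` to `f ^ p` reduces to `p = 1`, and the coarea formula reduces to
finite sets. Let `Ω` have size at most `x` and boundary too small relative to its size, and put `L =
log x`. The points of `Ω` with a given permutation form a fibre in `H`. Fibres of size at most `L`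
have large boundary in `H`, so most points of `Ω` lie in longer ones; moreover `Ω` is almost
invariant under swaps with a large fixed set `B`. Some non-empty set of permutations then has, at
every element, a definite proportion of all swaps along its fibre. Freezing positions one by one,
each with more than `|B| / 8` values, can go on for more than `L / 16` steps, so `|Ω| ≥ (|B| / 8) ^
k` with `k > L / 16`. As `|B| / 8 ≥ exp 16`, this exceeds `x`, a contradiction
(`pow_le_card_of_forall_many_swaps`, `pow_le_card_of_outBoundary`). -/

/-! ### Translation defects and change of generating set. -/

section GeneralProfile

variable {G : Type*} [Group G]

/-- The `p`-th power of the `ℓ^p`-distance between `f` and its right translate by `t`. -/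
noncomputable def translationDefect (p : ℝ) (f : G →₀ ℝ≥0) (t : G) : ℝ≥0∞ :=
  ∑' g : G, ENNReal.ofReal |(f g : ℝ) - (f (g * t) : ℝ)| ^ p

theorem lpNormGrad_eq (S : Finset G) (p : ℝ) (f : G →₀ ℝ≥0) :
    lpNormGrad S p f = (∑ s ∈ S, translationDefect p f s) ^ (1 / p) := by
  unfold lpNormGrad translationDefect
  rw [Summable.tsum_finsetSum fun _ _ => ENNReal.summable]

theorem translationDefect_one {p : ℝ} (hp : 1 ≤ p) (f : G →₀ ℝ≥0) :
    translationDefect p f 1 = 0 := by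
  have : 0 < p := by linarith
  simp [translationDefect, ENNReal.zero_rpow_of_pos this]

theorem translationDefect_inv (p : ℝ) (f : G →₀ ℝ≥0) (t : G) :
    translationDefect p f t⁻¹ = translationDefect p f t := by
  unfold translationDefect
  rw [← (Equiv.mulRight t).tsum_eq]
  simp [abs_sub_comm]

theorem translationDefect_mul_le {p : ℝ} (hp : 1 ≤ p) (f : G →₀ ℝ≥0) (t u : G) :
    translationDefect p f (t * u) ≤
      2 ^ (p - 1) * (translationDefect p f t + translationDefect p f u) := by
  have hu : translationDefect p f u =
      ∑' g : G, ENNReal.ofReal |(f (g * t) : ℝ) - (f (g * t * u) : ℝ)| ^ p := by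
    unfold translationDefect
    rw [← (Equiv.mulRight t).tsum_eq]
    simp
  rw [hu]
  unfold translationDefect
  rw [← ENNReal.tsum_add, ← ENNReal.tsum_mul_left]
  refine ENNReal.tsum_le_tsum fun g => ?_
  refine le_trans ?_ (ENNReal.rpow_add_le_mul_rpow_add_rpow _ _ hp)
  refine ENNReal.rpow_le_rpow ?_ (by linarith)
  rw [← ENNReal.ofReal_add (abs_nonneg _) (abs_nonneg _), ← mul_assoc]
  exact ENNReal.ofReal_le_ofReal (abs_sub_le _ _ _)

/-- Write `t` as a word in `T`: the defect is invariant under inversion and, by convexity,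
subadditive up to `2 ^ (p - 1)`. The constant depends on `t` but not on `f`. -/
theorem exists_translationDefect_le {p : ℝ} (hp : 1 ≤ p) (T : Finset G) {t : G}
    (ht : t ∈ Subgroup.closure (T : Set G)) :
    ∃ C : ℝ≥0, ∀ f : G →₀ ℝ≥0,
      translationDefect p f t ≤ C * ∑ s ∈ T, translationDefect p f s := by
  induction ht using Subgroup.closure_induction with
  | mem x hx =>
    refine ⟨1, fun f => ?_⟩
    rw [ENNReal.coe_one, one_mul]
    exact Finset.single_le_sum (f := fun s => translationDefect p f s)
      (fun _ _ => zero_le) (Finset.mem_coe.1 hx)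
  | one => exact ⟨0, fun f => by simp [translationDefect_one hp]⟩
  | mul x y _ _ hx hy =>
    obtain ⟨C, hC⟩ := hx
    obtain ⟨D, hD⟩ := hy
    refine ⟨2 ^ (p - 1) * (C + D), fun f => (translationDefect_mul_le hp f x y).trans ?_⟩
    have h2 : ((2 ^ (p - 1) * (C + D) : ℝ≥0) : ℝ≥0∞) = 2 ^ (p - 1) * ((C : ℝ≥0∞) + D) := by
      rw [ENNReal.coe_mul, ENNReal.coe_rpow_of_nonneg _ (by linarith)]
      simp
    rw [h2, mul_assoc, add_mul]
    gcongr
    · exact hC f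
    · exact hD f
  | inv x _ hx =>
    obtain ⟨C, hC⟩ := hx
    exact ⟨C, fun f => by rw [translationDefect_inv]; exact hC f⟩

theorem exists_sum_translationDefect_le {p : ℝ} (hp : 1 ≤ p) (T U : Finset G)
    (hT : Subgroup.closure (T : Set G) = ⊤) :
    ∃ C : ℝ≥0, 0 < C ∧ ∀ f : G →₀ ℝ≥0,
      ∑ u ∈ U, translationDefect p f u ≤ C * ∑ s ∈ T, translationDefect p f s := by
  choose C hC using fun t : G => exists_translationDefect_le hp T (t := t) (by simp [hT])
  refine ⟨∑ u ∈ U, C u + 1, by positivity, fun f => ?_⟩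
  calc ∑ u ∈ U, translationDefect p f u
      ≤ ∑ u ∈ U, C u * ∑ s ∈ T, translationDefect p f s := Finset.sum_le_sum fun u _ => hC u f
    _ = (∑ u ∈ U, (C u : ℝ≥0∞)) * ∑ s ∈ T, translationDefect p f s := by rw [Finset.sum_mul]
    _ ≤ _ := by
      gcongr
      rw [ENNReal.coe_add, ENNReal.ofNNReal_finsetSum]
      exact le_self_add

theorem ENNReal.div_le_mul_div_of_le_mul {a b c k : ℝ≥0∞} (hk : k ≠ 0) (hk' : k ≠ ⊤)
    (h : c ≤ k * b) : a / b ≤ k * (a / c) := by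
  have h1 : k⁻¹ * c ≤ b := by
    rw [mul_comm, ← ENNReal.div_eq_inv_mul.trans (mul_comm _ _)]
    exact ENNReal.div_le_of_le_mul' h
  calc a / b ≤ a / (k⁻¹ * c) := ENNReal.div_le_div_left h1 a
    _ = k * (a / c) := by
      rw [div_eq_mul_inv, ENNReal.mul_inv (by simp [hk']) (by simp [hk]), inv_inv, div_eq_mul_inv]
      ring

theorem lpNormGrad_le_of_sum_le {G' : Type*} [Group G'] {p : ℝ} (hp : 1 ≤ p) {S : Finset G}
    {T : Finset G'} {f : G →₀ ℝ≥0} {g : G' →₀ ℝ≥0} {C : ℝ≥0∞}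
    (h : ∑ t ∈ T, translationDefect p g t ≤ C * ∑ s ∈ S, translationDefect p f s) :
    lpNormGrad T p g ≤ C ^ (1 / p) * lpNormGrad S p f := by
  have hp' : 0 ≤ 1 / p := by positivity
  rw [lpNormGrad_eq, lpNormGrad_eq, ← ENNReal.mul_rpow_of_nonneg _ _ hp']
  exact ENNReal.rpow_le_rpow h hp'

theorem le_isoProfile (S : Finset G) (p : ℝ) {x : ℝ} {f : G →₀ ℝ≥0} (hf : f ≠ 0)
    (hx : (f.support.card : ℝ) ≤ x) : lpNormFin p f / lpNormGrad S p f ≤ isoProfile S p x :=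
  le_iSup_of_le f (le_iSup_of_le hf (le_iSup_of_le hx le_rfl))

theorem isoProfile_le {S : Finset G} {p : ℝ} {x : ℝ} {c : ℝ≥0∞}
    (h : ∀ f : G →₀ ℝ≥0, f ≠ 0 → (f.support.card : ℝ) ≤ x →
      lpNormFin p f / lpNormGrad S p f ≤ c) : isoProfile S p x ≤ c :=
  iSup_le fun f => iSup_le fun hf => iSup_le fun hx => h f hf hx

/-- The isoperimetric profiles with respect to a generating set are, up to a constant, the largest
among all finite sets. -/
theorem exists_isoProfile_le_of_closure_eq_top {p : ℝ} (hp : 1 ≤ p) (T U : Finset G)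
    (hT : Subgroup.closure (T : Set G) = ⊤) :
    ∃ C : ℝ≥0, 0 < C ∧ ∀ x, isoProfile T p x ≤ C * isoProfile U p x := by
  obtain ⟨C, hC0, hC⟩ := exists_sum_translationDefect_le hp T U hT
  have hp' : 0 ≤ 1 / p := by positivity
  refine ⟨C ^ (1 / p), NNReal.rpow_pos hC0, fun x => isoProfile_le fun f hf hx => ?_⟩
  rw [ENNReal.coe_rpow_of_nonneg _ hp']
  refine (ENNReal.div_le_mul_div_of_le_mul ?_ ?_ (lpNormGrad_le_of_sum_le hp (hC f))).trans ?_
  · simp [hC0.ne']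
  · simp [hC0.ne']
  · gcongr
    exact le_isoProfile U p hf hx

/-! ### From exponent `p` to exponent `1`. -/

/-- Bernoulli's inequality at `b / a - 1`, multiplied by `a ^ p`. -/
theorem Real.rpow_sub_rpow_le_mul {a b p : ℝ} (hb : 0 ≤ b) (hab : b ≤ a) (hp : 1 ≤ p) :
    a ^ p - b ^ p ≤ p * a ^ (p - 1) * (a - b) := by
  rcases hb.trans hab |>.eq_or_lt with h0 | ha
  · have : b = 0 := le_antisymm (h0 ▸ hab) hb
    simp [← h0, this]
  · have h := one_add_mul_self_le_rpow_one_add (s := b / a - 1)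
      (by have := div_nonneg hb ha.le; linarith) hp
    rw [add_sub_cancel, Real.div_rpow hb ha.le, le_div_iff₀ (by positivity)] at h
    have h2 : a ^ p = a ^ (p - 1) * a := by
      rw [← Real.rpow_add_one ha.ne']; simp
    have h3 : b / a * a = b := div_mul_cancel₀ b ha.ne'
    rw [h2] at h ⊢
    have h4 : (1 + p * (b / a - 1)) * (a ^ (p - 1) * a) =
        a ^ (p - 1) * a + p * a ^ (p - 1) * (b / a * a - a) := by ring
    rw [h4, h3] at h
    linarith

/-- A Young-type inequality, with a free scale `r`, for the variation of a `p`-th power. -/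
theorem Real.abs_rpow_sub_rpow_le {a b p r : ℝ} (ha : 0 ≤ a) (hb : 0 ≤ b) (hp : 1 ≤ p)
    (hr : 0 < r) :
    |a ^ p - b ^ p| ≤ p * (r ^ (1 - p) * |a - b| ^ p + r * (a ^ p + b ^ p)) := by
  wlog hab : b ≤ a generalizing a b
  · have := this hb ha (le_of_not_ge hab)
    rwa [abs_sub_comm, abs_sub_comm a, add_comm (a ^ p)]
  have hp0 : 0 ≤ p := by linarith
  have hd : 0 ≤ a - b := sub_nonneg.2 hab
  rw [abs_of_nonneg hd, abs_of_nonneg (sub_nonneg.2 (Real.rpow_le_rpow hb hab hp0))]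
  refine (Real.rpow_sub_rpow_le_mul hb hab hp).trans ?_
  rw [mul_assoc]
  refine mul_le_mul_of_nonneg_left ?_ hp0
  have hA : 0 ≤ r ^ (1 - p) * (a - b) ^ p := by positivity
  have hB : 0 ≤ b ^ p := by positivity
  -- For a small increment the factor `a - b` is at most `r * a`; for a large one `a` is at most `(a
  -- - b) / r`.
  rcases le_total (a - b) (r * a) with h | h
  · have h1 : a ^ (p - 1) * (a - b) ≤ a ^ (p - 1) * (r * a) := by gcongr
    have h2 : a ^ (p - 1) * a = a ^ p := by
      rcases ha.eq_or_lt with h0 | h0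
      · simp [← h0, Real.zero_rpow (show p ≠ 0 by linarith)]
      · rw [← Real.rpow_add_one h0.ne']; simp
    nlinarith
  · have h1 : a ^ (p - 1) ≤ ((a - b) / r) ^ (p - 1) := by
      refine Real.rpow_le_rpow ha ?_ (by linarith)
      rw [le_div_iff₀ hr]; linarith
    have h2 : ((a - b) / r) ^ (p - 1) * (a - b) = r ^ (1 - p) * (a - b) ^ p := by
      rw [Real.div_rpow hd hr.le, show (1 - p) = -(p - 1) by ring, Real.rpow_neg hr.le]
      have : (a - b) ^ (p - 1) * (a - b) = (a - b) ^ p := by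
        rcases hd.eq_or_lt with h0 | h0
        · simp [← h0, Real.zero_rpow (show p ≠ 0 by linarith)]
        · rw [← Real.rpow_add_one h0.ne']; simp
      rw [← this]; ring
    have h3 := mul_le_mul_of_nonneg_right h1 hd
    have h4 : 0 ≤ r * (a ^ p + b ^ p) := by positivity
    linarith

theorem translationDefect_rpow_le {p : ℝ} (hp : 1 ≤ p) (f : G →₀ ℝ≥0) (t : G) {r : ℝ}
    (hr : 0 < r) :
    translationDefect 1 (f.mapRange (fun a : ℝ≥0 => a ^ p)
      (NNReal.zero_rpow (by linarith))) t ≤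
      ENNReal.ofReal p * (ENNReal.ofReal (r ^ (1 - p)) * translationDefect p f t +
        ENNReal.ofReal r * (2 * ∑' g, (f g : ℝ≥0∞) ^ p)) := by
  have hp0 : 0 ≤ p := by linarith
  have hshift : ∑' g, (f (g * t) : ℝ≥0∞) ^ p = ∑' g, (f g : ℝ≥0∞) ^ p :=
    (Equiv.mulRight t).tsum_eq fun g => (f g : ℝ≥0∞) ^ p
  rw [two_mul]
  nth_rewrite 2 [← hshift]
  unfold translationDefect
  rw [← ENNReal.tsum_add, ← ENNReal.tsum_mul_left, ← ENNReal.tsum_mul_left, ← ENNReal.tsum_add,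
    ← ENNReal.tsum_mul_left]
  refine ENNReal.tsum_le_tsum fun g => ?_
  rw [ENNReal.rpow_one]
  simp only [Finsupp.mapRange_apply, NNReal.coe_rpow]
  refine (ENNReal.ofReal_le_ofReal (Real.abs_rpow_sub_rpow_le (f g).2 (f (g * t)).2 hp hr)).trans ?_
  have key : ∀ a : ℝ≥0, (a : ℝ≥0∞) ^ p = ENNReal.ofReal ((a : ℝ) ^ p) := fun a => by
    rw [← NNReal.coe_rpow, ENNReal.ofReal_coe_nnreal, ENNReal.coe_rpow_of_nonneg _ hp0]
  rw [key, key, ENNReal.ofReal_rpow_of_nonneg (abs_nonneg _) hp0,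
    ← ENNReal.ofReal_add (by positivity) (by positivity), ← ENNReal.ofReal_mul (by positivity),
    ← ENNReal.ofReal_mul (by positivity), ← ENNReal.ofReal_add (by positivity) (by positivity),
    ← ENNReal.ofReal_mul (by positivity)]
  rfl

theorem tsum_rpow_ne_zero {α : Type*} {p : ℝ} (hp : 1 ≤ p) {f : α →₀ ℝ≥0} (hf : f ≠ 0) :
    ∑' g, (f g : ℝ≥0∞) ^ p ≠ 0 := by
  obtain ⟨g, hg⟩ := Finsupp.ne_iff.1 hf
  intro h
  have := ENNReal.tsum_eq_zero.1 h g
  rw [ENNReal.rpow_eq_zero_iff_of_pos (by linarith)] at this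
  exact hg (by simpa using this)

theorem tsum_rpow_eq_sum {α : Type*} {p : ℝ} (hp : 1 ≤ p) (f : α →₀ ℝ≥0) :
    ∑' g, (f g : ℝ≥0∞) ^ p = ∑ g ∈ f.support, (f g : ℝ≥0∞) ^ p := by
  refine tsum_eq_sum fun g hg => ?_
  rw [Finsupp.notMem_support_iff.1 hg, ENNReal.coe_zero, ENNReal.zero_rpow_of_pos (by linarith)]

theorem tsum_rpow_ne_top {α : Type*} {p : ℝ} (hp : 1 ≤ p) (f : α →₀ ℝ≥0) :
    ∑' g, (f g : ℝ≥0∞) ^ p ≠ ⊤ := by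
  rw [tsum_rpow_eq_sum hp]
  exact ENNReal.sum_ne_top.2 fun g _ =>
    ENNReal.rpow_ne_top_of_nonneg (by linarith) ENNReal.coe_ne_top

/-- The `ℓ^p`-profile is dominated by the `ℓ^1`-profile. -/
theorem exists_isoProfile_le_one {p : ℝ} (hp : 1 ≤ p) (T : Finset G) :
    ∃ C : ℝ≥0, 0 < C ∧ ∀ x, isoProfile T p x ≤ C * isoProfile T 1 x := by
  have hp0 : 0 < p := by linarith
  have hC : 0 < p.toNNReal * (1 + 2 * (T.card : ℝ≥0)) := by positivity
  refine ⟨p.toNNReal * (1 + 2 * T.card), hC, fun x => isoProfile_le fun f hf hx => ?_⟩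
  set g : G →₀ ℝ≥0 := f.mapRange (fun a : ℝ≥0 => a ^ p) (NNReal.zero_rpow (by linarith)) with hg
  set N := ∑' g, (f g : ℝ≥0∞) ^ p with hN
  set D := ∑ s ∈ T, translationDefect p f s with hD
  have hsupp : g.support = f.support := by
    ext a
    simp [hg, hp0.ne']
  have hg0 : g ≠ 0 := by
    rw [← Finsupp.support_nonempty_iff, hsupp, Finsupp.support_nonempty_iff]; exact hf
  have hNg : lpNormFin 1 g = N := by
    simp only [lpNormFin, hg, Finsupp.mapRange_apply, one_div, inv_one, ENNReal.rpow_one, hN]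
    exact tsum_congr fun a => ENNReal.coe_rpow_of_nonneg _ hp0.le
  have hgrad : lpNormGrad T 1 g = ∑ s ∈ T, translationDefect 1 g s := by
    rw [lpNormGrad_eq]; simp
  have hbound : ∀ r : ℝ, 0 < r → lpNormGrad T 1 g ≤
      ENNReal.ofReal p * (ENNReal.ofReal (r ^ (1 - p)) * D +
        ENNReal.ofReal r * (2 * T.card * N)) := fun r hr => by
    rw [hgrad]
    refine (Finset.sum_le_sum fun s _ => translationDefect_rpow_le hp f s hr).trans_eq ?_
    rw [← Finset.mul_sum, Finset.sum_add_distrib, ← Finset.mul_sum, Finset.sum_const,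
      nsmul_eq_mul]
    ring
  have hN0 : N ≠ 0 := tsum_rpow_ne_zero hp hf
  have hNt : N ≠ ⊤ := tsum_rpow_ne_top hp f
  have hrw : lpNormFin p f / lpNormGrad T p f = (N / D) ^ (1 / p) := by
    rw [lpNormGrad_eq, ENNReal.div_rpow_of_nonneg _ _ (by positivity)]; rfl
  rw [hrw]
  refine le_trans ?_ (mul_le_mul_right (le_isoProfile T 1 hg0 (by rwa [hsupp])) _)
  rw [hNg]
  by_cases hDt : D = ⊤
  · simp [hDt, hp0]
  by_cases hD0 : D = 0
  -- With `D = 0` only the term linear in `r` survives in `hbound`; let `r` tend to `0`.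
  · have hz : lpNormGrad T 1 g = 0 := by
      have hlim : Filter.Tendsto (fun r : ℝ => ENNReal.ofReal p * (ENNReal.ofReal r *
          (2 * T.card * N))) (nhdsWithin 0 (Set.Ioi 0)) (nhds (ENNReal.ofReal p *
            (ENNReal.ofReal 0 * (2 * T.card * N)))) := by
        have hne : (2 * T.card * N : ℝ≥0∞) ≠ ⊤ :=
          ENNReal.mul_ne_top (ENNReal.mul_ne_top (by simp) (by simp)) hNt
        exact (ENNReal.Tendsto.const_mul (ENNReal.Tendsto.mul_const
          ((ENNReal.continuous_ofReal.tendsto 0).mono_left nhdsWithin_le_nhds)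
          (Or.inr hne)) (Or.inr ENNReal.ofReal_ne_top))
      refine le_antisymm ?_ zero_le
      refine (ge_of_tendsto hlim (Filter.eventually_of_mem self_mem_nhdsWithin fun r hr => ?_)).trans_eq
        (by simp)
      have := hbound r hr
      rwa [hD0, mul_zero, zero_add] at this
    rw [hz, ENNReal.div_zero hN0, ENNReal.mul_top]
    · exact le_top
    · exact_mod_cast hC.ne'
  have hND : (D / N).toReal ≠ 0 := by
    rw [ENNReal.toReal_ne_zero]
    exact ⟨ENNReal.div_ne_zero.2 ⟨hD0, hNt⟩, ENNReal.div_ne_top hDt hN0⟩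
  have hpos : 0 < (D / N).toReal := lt_of_le_of_ne ENNReal.toReal_nonneg hND.symm
  -- This scale balances the two terms of `hbound`: `r ^ (1 - p) * D = r * N`.
  set r := (D / N).toReal ^ (1 / p) with hr
  have hr0 : 0 < r := Real.rpow_pos_of_pos hpos _
  have hDr : D = ENNReal.ofReal (r ^ p) * N := by
    rw [hr, ← Real.rpow_mul hpos.le, one_div_mul_cancel hp0.ne', Real.rpow_one,
      ENNReal.ofReal_toReal (ENNReal.div_ne_top hDt hN0), ENNReal.div_mul_cancel hN0 hNt]
  have hb : lpNormGrad T 1 g ≤ (p.toNNReal * (1 + 2 * T.card) : ℝ≥0) * (ENNReal.ofReal r * N) := by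
    refine (hbound r hr0).trans_eq ?_
    rw [hDr, ← mul_assoc, ← ENNReal.ofReal_mul (by positivity), ← Real.rpow_add hr0,
      sub_add_cancel, Real.rpow_one]
    push_cast
    rw [show (p.toNNReal : ℝ≥0∞) = ENNReal.ofReal p from rfl]
    ring
  have h1 : (N / D) ^ (1 / p) = N / (ENNReal.ofReal r * N) := by
    have h2 : N / D = (ENNReal.ofReal (r ^ p))⁻¹ := by
      rw [hDr, div_eq_mul_inv,
        ENNReal.mul_inv (Or.inr hNt) (Or.inr hN0), mul_left_comm,
        ENNReal.mul_inv_cancel hN0 hNt, mul_one]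
    rw [h2, ← ENNReal.ofReal_rpow_of_pos hr0, ENNReal.inv_rpow, ← ENNReal.rpow_mul,
      mul_one_div_cancel hp0.ne', ENNReal.rpow_one, div_eq_mul_inv,
      ENNReal.mul_inv (Or.inr hNt) (Or.inr hN0), mul_left_comm,
        ENNReal.mul_inv_cancel hN0 hNt, mul_one]
  rw [h1]
  exact ENNReal.div_le_mul_div_of_le_mul (by exact_mod_cast hC.ne') ENNReal.coe_ne_top hb

end GeneralProfile

/-! ### Boundaries of finite sets and the `ℓ^1`-profile. -/

section Boundary

variable {G : Type*} [Group G] [DecidableEq G]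

/-- The number of points of `Ω` that right translation by `t` moves out of `Ω`. -/
def outBoundary (Ω : Finset G) (t : G) : ℕ := (Ω.filter fun g => g * t ∉ Ω).card

theorem outBoundary_le_card (Ω : Finset G) (t : G) : outBoundary Ω t ≤ Ω.card :=
  Finset.card_filter_le _ _

/-- Translation by `t` matches the points of `Ω` that `t` keeps in `Ω` with those that `t⁻¹` keeps
there; the complements in `Ω` then have equal size. -/
theorem outBoundary_inv (Ω : Finset G) (t : G) : outBoundary Ω t⁻¹ = outBoundary Ω t := by
  have h : (Ω.filter fun g => g * t ∈ Ω).card = (Ω.filter fun g => g * t⁻¹ ∈ Ω).card :=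
    Finset.card_bij' (fun g _ => g * t) (fun g _ => g * t⁻¹) (by simp; tauto) (by simp; tauto)
      (by simp) (by simp)
  have h1 := Finset.card_filter_add_card_filter_not (s := Ω) (fun g => g * t ∈ Ω)
  have h2 := Finset.card_filter_add_card_filter_not (s := Ω) (fun g => g * t⁻¹ ∈ Ω)
  unfold outBoundary
  omega

open MeasureTheory in
/-- Coarea: an isoperimetric inequality for finite sets bounds the `ℓ^1`-profile. -/
theorem isoProfile_one_le_of_forall_card_le (T : Finset G) {x : ℝ} {c : ℝ≥0∞}
    (h : ∀ Ω : Finset G, (Ω.card : ℝ) ≤ x →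
      (Ω.card : ℝ≥0∞) ≤ c * ∑ t ∈ T, (outBoundary Ω t : ℝ≥0∞)) :
    isoProfile T 1 x ≤ c := by
  refine isoProfile_le fun f _ hx => ENNReal.div_le_of_le_mul ?_
  have hN : lpNormFin 1 f = ∑ g ∈ f.support, (f g : ℝ≥0∞) := by
    simp only [lpNormFin, one_div, inv_one, ENNReal.rpow_one]
    simpa using tsum_rpow_eq_sum le_rfl f
  have hG : lpNormGrad T 1 f = ∑ t ∈ T, translationDefect 1 f t := by
    rw [lpNormGrad_eq]; simp
  rw [hN, hG]
  -- The superlevel sets of `f`: integrating their sizes over `r > 0` gives the norm, and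
  -- integrating their boundaries gives at most the gradient.
  set Ω : ℝ → Finset G := fun r => f.support.filter fun g => r < f g with hΩ
  have hmem : ∀ {r : ℝ}, 0 ≤ r → ∀ g, g ∈ Ω r ↔ r < f g := fun {r} hr g => by
    simp only [hΩ, Finset.mem_filter, Finsupp.mem_support_iff, and_iff_right_iff_imp]
    intro hg h0
    rw [h0] at hg
    exact absurd hg (by simpa using hr)
  have hcard : ∫⁻ r in Set.Ioi (0 : ℝ), ((Ω r).card : ℝ≥0∞) = ∑ g ∈ f.support, (f g : ℝ≥0∞) := by
    have : ∀ r, ((Ω r).card : ℝ≥0∞) =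
        ∑ g ∈ f.support, (Set.Iio (f g : ℝ)).indicator (fun _ => 1) r := fun r => by
      simp only [hΩ, Finset.card_filter, Set.indicator_apply, Set.mem_Iio]
      push_cast
      rfl
    simp_rw [this]
    rw [lintegral_finsetSum _ fun g _ => measurable_const.indicator measurableSet_Iio]
    refine Finset.sum_congr rfl fun g _ => ?_
    rw [lintegral_indicator_const measurableSet_Iio, Measure.restrict_apply measurableSet_Iio,
      Set.Iio_inter_Ioi, Real.volume_Ioo]
    simp
  have hind : ∀ t, ∀ r ∈ Set.Ioi (0 : ℝ), (outBoundary (Ω r) t : ℝ≥0∞) =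
      ∑ g ∈ f.support, (Set.Ico (f (g * t) : ℝ) (f g)).indicator (fun _ => 1) r := fun t r hr => by
    rw [outBoundary, hΩ, Finset.filter_filter, Finset.card_filter]
    push_cast
    refine Finset.sum_congr rfl fun g _ => ?_
    have := hmem (le_of_lt hr) (g * t)
    simp only [hΩ] at this
    simp only [this, Set.indicator_apply, Set.mem_Ico, not_lt, and_comm]
  have hcut : ∀ t, ∫⁻ r in Set.Ioi (0 : ℝ), (outBoundary (Ω r) t : ℝ≥0∞) ≤
      translationDefect 1 f t := fun t => by
    rw [setLIntegral_congr_fun measurableSet_Ioi (hind t),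
      lintegral_finsetSum _ fun g _ => measurable_const.indicator measurableSet_Ico]
    refine le_trans (Finset.sum_le_sum fun g _ => ?_) (ENNReal.sum_le_tsum f.support)
    rw [lintegral_indicator_const measurableSet_Ico, one_mul, ENNReal.rpow_one]
    refine (Measure.restrict_apply_le _ _).trans ?_
    rw [Real.volume_Ico]
    exact ENNReal.ofReal_le_ofReal (le_abs_self _)
  have hmeas : ∀ t, AEMeasurable (fun r => (outBoundary (Ω r) t : ℝ≥0∞))
      (volume.restrict (Set.Ioi (0 : ℝ))) := fun t => by
    refine (Finset.measurable_fun_sum f.support fun g _ =>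
      (measurable_const (a := (1 : ℝ≥0∞))).indicator
      (measurableSet_Ico (a := (f (g * t) : ℝ)) (b := f g))).aemeasurable.congr ?_
    filter_upwards [ae_restrict_mem measurableSet_Ioi] with r hr
    exact (hind t r hr).symm
  calc ∑ g ∈ f.support, (f g : ℝ≥0∞)
      = ∫⁻ r in Set.Ioi (0 : ℝ), ((Ω r).card : ℝ≥0∞) := hcard.symm
    _ ≤ ∫⁻ r in Set.Ioi (0 : ℝ), c * ∑ t ∈ T, (outBoundary (Ω r) t : ℝ≥0∞) := by
      refine lintegral_mono fun r => h _ (le_trans ?_ hx)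
      exact_mod_cast Finset.card_filter_le _ _
    _ = c * ∑ t ∈ T, ∫⁻ r in Set.Ioi (0 : ℝ), (outBoundary (Ω r) t : ℝ≥0∞) := by
      rw [lintegral_const_mul'' _ (Finset.aemeasurable_fun_sum _ fun t _ => hmeas t),
        lintegral_finsetSum' _ fun t _ => hmeas t]
    _ ≤ _ := by
      gcongr with t
      exact hcut t

/-- Test the profile on the indicator of `F`. Its gradient sees points leaving and points entering
`F`, equally many for each `s`, hence the factor `2`. -/
theorem card_le_isoProfile_mul (S : Finset G) {y : ℝ} (hJ : isoProfile S 1 y ≠ ⊤) (F : Finset G)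
    (hF : (F.card : ℝ) ≤ y) :
    (F.card : ℝ≥0∞) ≤ isoProfile S 1 y * (2 * ∑ s ∈ S, (outBoundary F s : ℝ≥0∞)) := by
  rcases F.eq_empty_or_nonempty with rfl | hne
  · simp
  set f : G →₀ ℝ≥0 := Finsupp.onFinset F (fun g => if g ∈ F then 1 else 0) (by simp) with hf
  have hfg : ∀ g, f g = if g ∈ F then 1 else 0 := fun g => rfl
  have hsupp : f.support = F := by ext; simp [hfg]
  have hf0 : f ≠ 0 := by rw [← Finsupp.support_nonempty_iff, hsupp]; exact hne
  have hN : lpNormFin 1 f = F.card := by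
    simp only [lpNormFin, one_div, inv_one, ENNReal.rpow_one]
    have := tsum_rpow_eq_sum le_rfl f
    simp only [ENNReal.rpow_one, hsupp] at this
    rw [this, Finset.sum_congr rfl fun g hg => by rw [hfg, if_pos hg]]
    simp
  have hG : lpNormGrad S 1 f ≤ 2 * ∑ s ∈ S, (outBoundary F s : ℝ≥0∞) := by
    rw [lpNormGrad_eq, one_div, inv_one, ENNReal.rpow_one, Finset.mul_sum]
    refine Finset.sum_le_sum fun s _ => ?_
    have hpt : ∀ g, ENNReal.ofReal |(f g : ℝ) - (f (g * s) : ℝ)| ^ (1 : ℝ) =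
        (if g ∈ F ∧ g * s ∉ F then 1 else 0) + (if g * s ∈ F ∧ g ∉ F then 1 else 0) := fun g => by
      rw [hfg, hfg]
      by_cases h1 : g ∈ F <;> by_cases h2 : g * s ∈ F <;> simp [h1, h2]
    have hsum : ∀ t : G, ∑' g, (if g ∈ F ∧ g * t ∉ F then (1 : ℝ≥0∞) else 0) = outBoundary F t :=
      fun t => by
        rw [tsum_eq_sum (s := F) (fun g hg => by simp [hg]), outBoundary, Finset.card_filter]
        push_cast
        exact Finset.sum_congr rfl fun g hg => by simp [hg]
    unfold translationDefect
    simp_rw [hpt]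
    rw [ENNReal.tsum_add, hsum, two_mul, ← outBoundary_inv F s, ← hsum s⁻¹,
      ← (Equiv.mulRight s).tsum_eq]
    simp
  have hJle := le_isoProfile S 1 (x := y) hf0 (by rwa [hsupp])
  have hg0 : lpNormGrad S 1 f ≠ 0 := fun h0 => by
    rw [h0, hN, ENNReal.div_zero (by simp [hne.ne_empty])] at hJle
    exact hJ (top_le_iff.1 hJle)
  have hgt : lpNormGrad S 1 f ≠ ⊤ := by
    refine ne_top_of_le_ne_top ?_ hG
    exact ENNReal.mul_ne_top (by simp) (ENNReal.sum_ne_top.2 fun _ _ => by simp)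
  rw [ENNReal.div_le_iff hg0 hgt, hN] at hJle
  exact hJle.trans (by gcongr)

end Boundary

/-! ### Exponential growth from many swaps. -/

section SwapGrowth

open Equiv

open scoped Classical

variable {H : Type*} [Group H]

theorem card_filter_product_eq_sum {α β : Type*} (A : Finset α) (B : Finset β)
    (P : α × β → Prop) [DecidablePred P] :
    ((A ×ˢ B).filter P).card = ∑ a ∈ A, (B.filter fun b => P (a, b)).card := by
  simp only [Finset.card_filter, Finset.sum_product]

/-- A finite set of permutations in which every element has many neighbours by transpositions
`(h hb)`, with boundedly many choices of `b` for each `h`, is exponentially large: the positions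
can be frozen one after the other, each time with a large choice of values. -/
theorem pow_le_card_of_forall_many_swaps {B : Finset H} (hB : B.Nonempty) {L : ℝ}
    {Y : Finset (Perm H)} {M : Perm H → Finset H} (hM : ∀ σ ∈ Y, L < (M σ).card)
    (hdeg : ∀ σ ∈ Y, B.card * (M σ).card ≤
      4 * ((M σ ×ˢ B).filter fun q => σ * swap q.1 (q.1 * q.2) ∈ Y).card) (k : ℕ) :
    ∀ (Z : Finset H) (v : H → H), (Z.card : ℝ) + k ≤ L / 16 + 1 →
      (Y.filter fun σ => ∀ z ∈ Z, σ z = v z).Nonempty →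
      ((B.card : ℝ) / 8) ^ k ≤ (Y.filter fun σ => ∀ z ∈ Z, σ z = v z).card := by
  induction k with
  | zero =>
    intro Z v _ hne
    simpa using hne.card_pos
  | succ k ih =>
    intro Z v hk hne
    obtain ⟨σ, hσ⟩ := hne
    obtain ⟨hσY, hσZ⟩ := Finset.mem_filter.1 hσ
    have hB0 : (0 : ℝ) < B.card := by exact_mod_cast hB.card_pos
    have hn := hM σ hσY
    push_cast at hk
    -- A swap is harmless for the frozen values if it avoids `Z`; each of its two ends lies in `Z`
    -- for at most `Z.card * B.card` pairs.
    have hsplit : ((M σ ×ˢ B).filter fun q => σ * swap q.1 (q.1 * q.2) ∈ Y).card ≤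
        ((M σ ×ˢ B).filter fun q => σ * swap q.1 (q.1 * q.2) ∈ Y ∧ q.1 ∉ Z ∧ q.1 * q.2 ∉ Z).card
          + 2 * (Z.card * B.card) := by
      have h1 : ((M σ ×ˢ B).filter fun q => q.1 ∈ Z).card ≤ Z.card * B.card := by
        rw [← Finset.card_product]
        refine Finset.card_le_card fun q hq => ?_
        simp only [Finset.mem_filter, Finset.mem_product] at hq ⊢
        exact ⟨hq.2, hq.1.2⟩
      have h2 : ((M σ ×ˢ B).filter fun q => q.1 * q.2 ∈ Z).card ≤ Z.card * B.card := by
        rw [← Finset.card_product]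
        refine Finset.card_le_card_of_injOn (fun q => (q.1 * q.2, q.2)) (fun q hq => ?_) ?_
        · simp only [Finset.coe_filter, Finset.mem_product, Set.mem_ofPred_eq] at hq
          simp only [Finset.coe_product, Set.mem_prod, Finset.mem_coe]
          exact ⟨hq.2, hq.1.2⟩
        · rintro ⟨a, b⟩ - ⟨a', b'⟩ - hab
          simp only [Prod.mk.injEq] at hab
          obtain ⟨h, rfl⟩ := hab
          simpa using h
      refine le_trans (le_trans (Finset.card_le_card fun q hq => ?_)
        ((Finset.card_union_le _ _).trans (Nat.add_le_add_left (Finset.card_union_le _ _) _)))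
        (Nat.add_le_add_left ((Nat.add_le_add h1 h2).trans_eq (two_mul _).symm) _)
      simp only [Finset.mem_union, Finset.mem_filter] at hq ⊢
      tauto
    rw [card_filter_product_eq_sum (M σ) B
      (fun q => σ * swap q.1 (q.1 * q.2) ∈ Y ∧ q.1 ∉ Z ∧ q.1 * q.2 ∉ Z)] at hsplit
    -- At least a quarter of all pairs stay in `Y`, and fewer than an eighth meet `Z` because `16 *
    -- Z.card < (M σ).card`. More than an eighth remain, so some `h` has more than `B.card / 8`
    -- usable `b`.
    have hlt : ∑ _h ∈ M σ, (B.card : ℝ) / 8 < ∑ h ∈ M σ, ((B.filter fun b =>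
        σ * swap h (h * b) ∈ Y ∧ h ∉ Z ∧ h * b ∉ Z).card : ℝ) := by
      have h1 : (B.card * (M σ).card : ℝ) ≤
        4 * ((M σ ×ˢ B).filter fun q => σ * swap q.1 (q.1 * q.2) ∈ Y).card := by
        exact_mod_cast hdeg σ hσY
      have h2 : ((((M σ ×ˢ B).filter fun q => σ * swap q.1 (q.1 * q.2) ∈ Y).card : ℕ) : ℝ) ≤
          ∑ h ∈ M σ, ((B.filter fun b => σ * swap h (h * b) ∈ Y ∧ h ∉ Z ∧ h * b ∉ Z).card : ℝ) +
            2 * (Z.card * B.card) := by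
        exact_mod_cast hsplit
      rw [Finset.sum_const, nsmul_eq_mul]
      have hZ : (16 : ℝ) * Z.card < (M σ).card := by
        have : (0 : ℝ) ≤ k := k.cast_nonneg
        linarith
      nlinarith
    obtain ⟨h, -, hh⟩ := Finset.exists_lt_of_sum_lt hlt
    set D := B.filter fun b => σ * swap h (h * b) ∈ Y ∧ h ∉ Z ∧ h * b ∉ Z with hD
    have hhZ : h ∉ Z := by
      have : 0 < D.card := by
        have : (0 : ℝ) < D.card := lt_trans (by positivity) hh
        exact_mod_cast this
      obtain ⟨b, hb⟩ := Finset.card_pos.1 this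
      exact (Finset.mem_filter.1 hb).2.2.1
    -- Freeze `h` at the value `σ (h * b)` created by the swap; different `b` prescribe different
    -- values, so these families are disjoint.
    let F : H → Finset (Perm H) := fun b =>
      Y.filter fun τ => ∀ z ∈ insert h Z, τ z = Function.update v h (σ (h * b)) z
    have hF : ∀ b ∈ D, ((B.card : ℝ) / 8) ^ k ≤ (F b).card := fun b hb => by
      obtain ⟨-, hbY, -, hbZ⟩ := Finset.mem_filter.1 hb
      refine ih _ _ ?_ ⟨σ * swap h (h * b), Finset.mem_filter.2 ⟨hbY, fun z hz => ?_⟩⟩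
      · rw [Finset.card_insert_of_notMem hhZ]
        push_cast
        linarith
      · rcases Finset.mem_insert.1 hz with rfl | hz
        · simp
        · have hzh : z ≠ h := fun e => hhZ (e ▸ hz)
          have hzb : z ≠ h * b := fun e => hbZ (e ▸ hz)
          rw [Function.update_of_ne hzh, Perm.mul_apply, swap_apply_of_ne_of_ne hzh hzb]
          exact hσZ z hz
    have hdisj : (D : Set H).PairwiseDisjoint F := fun b _ b' _ hbb' => by
      refine Finset.disjoint_left.2 fun τ hτ hτ' => hbb' ?_
      have e := (Finset.mem_filter.1 hτ).2 h (Finset.mem_insert_self _ _)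
      have e' := (Finset.mem_filter.1 hτ').2 h (Finset.mem_insert_self _ _)
      rw [Function.update_self] at e e'
      exact mul_left_cancel (σ.injective (e.symm.trans e'))
    have hsub : D.biUnion F ⊆ Y.filter fun τ => ∀ z ∈ Z, τ z = v z := fun τ hτ => by
      obtain ⟨b, _, hb⟩ := Finset.mem_biUnion.1 hτ
      obtain ⟨hY, hv⟩ := Finset.mem_filter.1 hb
      refine Finset.mem_filter.2 ⟨hY, fun z hz => ?_⟩
      rw [hv z (Finset.mem_insert_of_mem hz), Function.update_of_ne (ne_of_mem_of_not_mem hz hhZ)]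
    calc ((B.card : ℝ) / 8) ^ (k + 1) = B.card / 8 * (B.card / 8 : ℝ) ^ k := pow_succ' _ _
      _ ≤ D.card * (B.card / 8 : ℝ) ^ k := by gcongr
      _ = ∑ b ∈ D, (B.card / 8 : ℝ) ^ k := by rw [Finset.sum_const, nsmul_eq_mul]
      _ ≤ ∑ b ∈ D, ((F b).card : ℝ) := Finset.sum_le_sum hF
      _ = (D.biUnion F).card := by rw [Finset.card_biUnion hdisj]; push_cast; rfl
      _ ≤ _ := by exact_mod_cast Finset.card_le_card hsub

/-- The fibre of `Ω` over a first coordinate. -/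
noncomputable def fiberOver {α β : Type*} (Ω : Finset (α × β)) (a : α) : Finset β :=
  (Ω.filter fun w => w.1 = a).image Prod.snd

theorem mem_fiberOver {α β : Type*} {Ω : Finset (α × β)} {a : α} {b : β} :
    b ∈ fiberOver Ω a ↔ (a, b) ∈ Ω := by
  simp [fiberOver]

theorem card_fiberOver {α β : Type*} (Ω : Finset (α × β)) (a : α) :
    (fiberOver Ω a).card = (Ω.filter fun w => w.1 = a).card := by
  refine Finset.card_image_of_injOn ?_
  rintro ⟨a, b⟩ ha ⟨a', b'⟩ ha' (rfl : b = b')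
  simp only [Finset.coe_filter, Set.mem_ofPred_eq] at ha ha'
  rw [Prod.mk.injEq]
  exact ⟨ha.2.trans ha'.2.symm, rfl⟩

/-- Right multiplication by the transposition of `1` and `b` in the lampshuffler group. -/
noncomputable def swapStep (w : Perm H × H) (b : H) : Perm H × H := (w.1 * swap w.2 (w.2 * b), w.2)

theorem swapStep_swapStep (w : Perm H × H) (b : H) : swapStep (swapStep w b) b = w := by
  simp [swapStep, mul_assoc]

/-- A set of permutations with many swap edges contains a non-empty subset of large minimal
degree. -/
theorem exists_subset_many_swaps (Ω : Finset (Perm H × H)) (B : Finset H) (Y₀ : Finset (Perm H))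
    (h : B.card * (Ω.filter fun w => w.1 ∈ Y₀).card < 2 * ((Ω ×ˢ B).filter fun q =>
      q.1.1 ∈ Y₀ ∧ swapStep q.1 q.2 ∈ Ω ∧ (swapStep q.1 q.2).1 ∈ Y₀).card) :
    ∃ Y ⊆ Y₀, Y.Nonempty ∧ ∀ σ ∈ Y, B.card * (fiberOver Ω σ).card ≤
      4 * ((fiberOver Ω σ ×ˢ B).filter fun q => σ * swap q.1 (q.1 * q.2) ∈ Y).card := by
  let E : Finset (Perm H) → ℕ := fun Y => ((Ω ×ˢ B).filter fun q =>
      q.1.1 ∈ Y ∧ swapStep q.1 q.2 ∈ Ω ∧ (swapStep q.1 q.2).1 ∈ Y).card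
  let W : Finset (Perm H) → ℕ := fun Y => (Ω.filter fun w => w.1 ∈ Y).card
  -- A maximiser beats the empty set, whose value is `0`, so it is non-empty. Deleting `σ` from it
  -- loses at most `2 * d` edges, outgoing and incoming, which forces the degree bound.
  obtain ⟨Y, hY, hmax⟩ := Finset.exists_max_image Y₀.powerset
    (fun Y => (2 * E Y : ℤ) - B.card * W Y) ⟨Y₀, Finset.mem_powerset_self _⟩
  refine ⟨Y, Finset.mem_powerset.1 hY, ?_, fun σ hσ => ?_⟩
  · rw [Finset.nonempty_iff_ne_empty]
    rintro rfl
    have h1 := hmax Y₀ (Finset.mem_powerset_self _)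
    have h2 : (B.card * W Y₀ : ℤ) < 2 * E Y₀ := by exact_mod_cast h
    have h3 : E ∅ = 0 := by simp [E]
    have h4 : W ∅ = 0 := by simp [W]
    rw [h3, h4] at h1
    push_cast at h1
    linarith
  · have h1 := hmax (Y.erase σ) (Finset.mem_powerset.2
      ((Finset.erase_subset _ _).trans (Finset.mem_powerset.1 hY)))
    set d := ((fiberOver Ω σ ×ˢ B).filter fun q => σ * swap q.1 (q.1 * q.2) ∈ Y).card with hd
    have hW : W Y = W (Y.erase σ) + (fiberOver Ω σ).card := by
      rw [card_fiberOver]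
      simp only [W]
      rw [← Finset.card_union_of_disjoint]
      · congr 1
        ext w
        simp only [Finset.mem_union, Finset.mem_filter, Finset.mem_erase]
        constructor
        · rintro ⟨hw, hwY⟩
          by_cases e : w.1 = σ <;> tauto
        · rintro (⟨hw, -, hwY⟩ | ⟨hw, e⟩)
          · exact ⟨hw, hwY⟩
          · exact ⟨hw, e ▸ hσ⟩
      · refine Finset.disjoint_left.2 fun w hw hw' => ?_
        simp only [Finset.mem_filter, Finset.mem_erase] at hw hw'
        exact hw.2.1 hw'.2
    have hout : ((Ω ×ˢ B).filter fun q => q.1.1 = σ ∧ swapStep q.1 q.2 ∈ Ω ∧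
        (swapStep q.1 q.2).1 ∈ Y).card ≤ d := by
      refine Finset.card_le_card_of_injOn (fun q => (q.1.2, q.2)) ?_ ?_
      · rintro ⟨⟨τ, x⟩, b⟩ hq
        simp only [Finset.coe_filter, Finset.mem_product, Set.mem_ofPred_eq] at hq ⊢
        obtain ⟨⟨hΩ, hb⟩, rfl, -, hs⟩ := hq
        exact ⟨⟨mem_fiberOver.2 hΩ, hb⟩, hs⟩
      · rintro ⟨⟨τ, x⟩, b⟩ hq ⟨⟨τ', x'⟩, b'⟩ hq' e
        simp only [Finset.coe_filter, Finset.mem_product, Set.mem_ofPred_eq] at hq hq'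
        simp only [Prod.mk.injEq] at e ⊢
        exact ⟨⟨hq.2.1.trans hq'.2.1.symm, e.1⟩, e.2⟩
    have hin : ((Ω ×ˢ B).filter fun q => q.1.1 ∈ Y ∧ swapStep q.1 q.2 ∈ Ω ∧
        (swapStep q.1 q.2).1 = σ).card ≤ d := by
      refine le_trans (Finset.card_le_card_of_injOn (fun q => (swapStep q.1 q.2, q.2)) ?_ ?_) hout
      · rintro ⟨w, b⟩ hq
        simp only [Finset.coe_filter, Finset.mem_product, Set.mem_ofPred_eq,
          swapStep_swapStep] at hq ⊢
        tauto
      · rintro ⟨w, b⟩ - ⟨w', b'⟩ - e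
        simp only [Prod.mk.injEq] at e ⊢
        obtain ⟨e, rfl⟩ := e
        exact ⟨by rw [← swapStep_swapStep w b, e, swapStep_swapStep], rfl⟩
    have hE : E Y ≤ E (Y.erase σ) + (d + d) := by
      refine le_trans (le_trans (Finset.card_le_card fun q hq => ?_)
        ((Finset.card_union_le _ _).trans (Nat.add_le_add_left (Finset.card_union_le _ _) _)))
        (Nat.add_le_add_left (Nat.add_le_add hout hin) _)
      simp only [Finset.mem_union, Finset.mem_filter, Finset.mem_erase] at hq ⊢
      tauto
    rw [hW] at h1
    push_cast at h1
    zify at hE ⊢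
    linarith

/-- A finite set with few short fibres that is nearly invariant under swaps is exponentially
large in the length of the fibres. -/
theorem pow_le_card_of_fibers {B : Finset H} (hB : B.Nonempty) {L : ℝ}
    {Ω : Finset (Perm H × H)} (hΩ : Ω.Nonempty)
    (hfib : 8 * (Ω.filter fun w => ((fiberOver Ω w.1).card : ℝ) ≤ L).card ≤ Ω.card)
    (hswap : 8 * ((Ω ×ˢ B).filter fun q => swapStep q.1 q.2 ∉ Ω).card ≤ B.card * Ω.card)
    (k : ℕ) (hk : (k : ℝ) ≤ L / 16 + 1) : ((B.card : ℝ) / 8) ^ k ≤ Ω.card := by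
  set Y₀ := (Ω.image Prod.fst).filter fun σ => L < (fiberOver Ω σ).card with hY₀
  have hmem : ∀ w ∈ Ω, (w.1 ∈ Y₀ ↔ ¬ ((fiberOver Ω w.1).card : ℝ) ≤ L) := fun w hw => by
    simp only [hY₀, Finset.mem_filter, Finset.mem_image, not_le, and_iff_right_iff_imp]
    exact fun _ => ⟨w, hw, rfl⟩
  have hbad : ((Ω ×ˢ B).filter fun q => q.1.1 ∉ Y₀).card ≤
      (Ω.filter fun w => ((fiberOver Ω w.1).card : ℝ) ≤ L).card * B.card := by
    rw [← Finset.card_product]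
    refine Finset.card_le_card fun q hq => ?_
    simp only [Finset.mem_filter, Finset.mem_product] at hq ⊢
    have := hmem q.1 hq.1.1
    tauto
  have hbad' : ((Ω ×ˢ B).filter fun q => swapStep q.1 q.2 ∈ Ω ∧ (swapStep q.1 q.2).1 ∉ Y₀).card ≤
      (Ω.filter fun w => ((fiberOver Ω w.1).card : ℝ) ≤ L).card * B.card := by
    refine le_trans (Finset.card_le_card_of_injOn (fun q => (swapStep q.1 q.2, q.2)) ?_ ?_) hbad
    · rintro ⟨w, b⟩ hq
      simp only [Finset.coe_filter, Finset.mem_product, Set.mem_ofPred_eq] at hq ⊢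
      tauto
    · rintro ⟨w, b⟩ - ⟨w', b'⟩ - e
      simp only [Prod.mk.injEq] at e ⊢
      obtain ⟨e, rfl⟩ := e
      exact ⟨by rw [← swapStep_swapStep w b, e, swapStep_swapStep], rfl⟩
  set e := ((Ω ×ˢ B).filter fun q =>
      q.1.1 ∈ Y₀ ∧ swapStep q.1 q.2 ∈ Ω ∧ (swapStep q.1 q.2).1 ∈ Y₀).card with he
  have htot : Ω.card * B.card ≤ e + (((Ω ×ˢ B).filter fun q => q.1.1 ∉ Y₀).card +
      (((Ω ×ˢ B).filter fun q => swapStep q.1 q.2 ∉ Ω).card + ((Ω ×ˢ B).filter fun q =>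
        swapStep q.1 q.2 ∈ Ω ∧ (swapStep q.1 q.2).1 ∉ Y₀).card)) := by
    rw [← Finset.card_product]
    refine le_trans (Finset.card_le_card fun q hq => ?_)
      ((Finset.card_union_le _ _).trans (Nat.add_le_add_left ((Finset.card_union_le _ _).trans
        (Nat.add_le_add_left (Finset.card_union_le _ _) _)) _))
    simp only [Finset.mem_union, Finset.mem_filter]
    tauto
  have hpos : 0 < Ω.card * B.card := Nat.mul_pos hΩ.card_pos hB.card_pos
  -- Short initial fibre, swap leaving `Ω` and short final fibre each exclude at most an eighth of
  -- the pairs, so more than half survive.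
  have hlt : B.card * (Ω.filter fun w => w.1 ∈ Y₀).card < 2 * e := by
    have h1 : B.card * (Ω.filter fun w => w.1 ∈ Y₀).card ≤ B.card * Ω.card :=
      Nat.mul_le_mul_left _ (Finset.card_filter_le _ _)
    have h2 := Nat.mul_le_mul_right B.card hfib
    nlinarith
  obtain ⟨Y, hYY₀, ⟨σ, hσ⟩, hdeg⟩ := exists_subset_many_swaps Ω B Y₀ hlt
  have := pow_le_card_of_forall_many_swaps hB (L := L)
    (fun σ hσ => (Finset.mem_filter.1 (hYY₀ hσ)).2) hdeg k ∅ id (by simpa using hk)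
    ⟨σ, by simpa using hσ⟩
  refine this.trans ?_
  have hle : (Y.filter fun σ => ∀ z ∈ (∅ : Finset H), σ z = id z).card ≤ Ω.card :=
    (Finset.card_filter_le _ _).trans ((Finset.card_le_card (hYY₀.trans
      (Finset.filter_subset _ _))).trans Finset.card_image_le)
  exact_mod_cast hle

end SwapGrowth

/-! ### Generators of the lampshuffler group and the upper bound. -/

section Lampshuffler

open Equiv

open scoped Classical

variable {H : Type*} [Group H]

/-- A transposition as a finitely supported permutation. -/
noncomputable def finSwap {X : Type*} (a b : X) : finSym X :=
  ⟨swap a b, (Set.toFinite {a, b}).subset fun x hx => by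
    by_contra h
    simp only [Set.mem_insert_iff, Set.mem_singleton_iff, not_or] at h
    exact hx (swap_apply_of_ne_of_ne h.1 h.2)⟩

theorem finSwap_injective {X : Type*} (a : X) : Function.Injective (finSwap a) := fun b c h => by
  have := congrArg (fun σ : finSym X => (σ : Perm X) a) h
  simpa [finSwap] using this

theorem shufAction_finSwap (h a b : H) :
    shufAction H h (finSwap a b) = finSwap (h * a) (h * b) := by
  ext x
  rw [shufAction_apply]
  have hiff : ∀ c, h⁻¹ * x = c ↔ x = h * c := fun c => inv_mul_eq_iff_eq_mul
  simp only [finSwap, swap_apply_def, hiff]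
  split_ifs <;> simp

theorem mul_inl_finSwap (w : Lampshuffler H) (b : H) :
    w * SemidirectProduct.inl (finSwap 1 b) =
      ⟨w.left * finSwap w.right (w.right * b), w.right⟩ := by
  ext <;> simp [shufAction_finSwap]

theorem mul_inr (w : Lampshuffler H) (s : H) :
    w * SemidirectProduct.inr s = ⟨w.left, w.right * s⟩ := by
  ext <;> simp

/-- The lampshuffler elements given by translations by `S` and transpositions `(1 b)` with
`b ∈ B`. -/
noncomputable def shufflerMoves (S B : Finset H) : Finset (Lampshuffler H) :=
  S.image (fun s => SemidirectProduct.inr s) ∪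
    B.image (fun b => SemidirectProduct.inl (finSwap 1 b))

theorem inr_mem_shufflerMoves {S B : Finset H} {s : H} (hs : s ∈ S) :
    SemidirectProduct.inr s ∈ shufflerMoves S B :=
  Finset.mem_union_left _ (Finset.mem_image_of_mem _ hs)

theorem inl_mem_shufflerMoves {S B : Finset H} {b : H} (hb : b ∈ B) :
    SemidirectProduct.inl (finSwap 1 b) ∈ shufflerMoves S B :=
  Finset.mem_union_right _ (Finset.mem_image_of_mem (fun b => SemidirectProduct.inl (finSwap 1 b)) hb)

theorem inl_finSwap_injective :
    Function.Injective fun b : H => (SemidirectProduct.inl (finSwap 1 b) : Lampshuffler H) :=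
  SemidirectProduct.inl_injective.comp (finSwap_injective 1)

/-- A group generated by transpositions contains every finitely supported permutation that preserves
its orbits. Here there is only one orbit, since the Cayley graph of `S` is connected. -/
theorem closure_swap_eq (S : Finset H) (hS : Subgroup.closure (S : Set H) = ⊤) {σ : Perm H}
    (hσ : σ ∈ finSym H) :
    σ ∈ Subgroup.closure {τ : Perm H | ∃ h : H, ∃ s ∈ S, s ≠ 1 ∧ swap h (h * s) = τ} := by
  set A := {τ : Perm H | ∃ h : H, ∃ s ∈ S, s ≠ 1 ∧ swap h (h * s) = τ} with hA
  have hswap : ∀ τ ∈ A, τ.IsSwap := by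
    rintro τ ⟨h, s, -, hs1, rfl⟩
    exact ⟨h, h * s, by simpa using hs1, rfl⟩
  have horb : ∀ g : H, ∀ x : H, x * g ∈ MulAction.orbit (Subgroup.closure A) x := fun g => by
    have hg : g ∈ Subgroup.closure (S : Set H) := by simp [hS]
    induction hg using Subgroup.closure_induction with
    | mem s hs =>
      intro x
      by_cases h1 : s = 1
      · rw [h1, mul_one]; exact MulAction.mem_orbit_self x
      · exact ⟨⟨swap x (x * s), Subgroup.subset_closure ⟨x, s, hs, h1, rfl⟩⟩,
          swap_apply_left x (x * s)⟩
    | one => intro x; rw [mul_one]; exact MulAction.mem_orbit_self x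
    | mul a b _ _ ha hb =>
      intro x
      have := hb (x * a)
      rwa [MulAction.orbit_eq_iff.2 (ha x), mul_assoc] at this
    | inv a _ ha =>
      intro x
      have := ha (x * a⁻¹)
      rw [inv_mul_cancel_right] at this
      exact MulAction.mem_orbit_symm.1 this
  refine (mem_closure_isSwap hswap).2 ⟨hσ, fun x => ?_⟩
  simpa using horb (x⁻¹ * σ x) x

theorem closure_shufflerMoves (S : Finset H) (hS : Subgroup.closure (S : Set H) = ⊤) :
    Subgroup.closure (shufflerMoves S S : Set (Lampshuffler H)) = ⊤ := by
  set C := Subgroup.closure (shufflerMoves S S : Set (Lampshuffler H)) with hC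
  have hr : ∀ h : H, SemidirectProduct.inr h ∈ C := fun h => by
    have : Subgroup.closure (S : Set H) ≤ C.comap SemidirectProduct.inr :=
      (Subgroup.closure_le _).2 fun s hs =>
        Subgroup.subset_closure (Finset.mem_coe.2 (inr_mem_shufflerMoves (Finset.mem_coe.1 hs)))
    exact this (by simp [hS])
  have hl : ∀ σ : finSym H, SemidirectProduct.inl σ ∈ C := fun σ => by
    have hle : Subgroup.closure {τ : Perm H | ∃ h : H, ∃ s ∈ S, s ≠ 1 ∧ swap h (h * s) = τ} ≤
        (C.comap SemidirectProduct.inl).map (finSym H).subtype := by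
      rw [Subgroup.closure_le]
      rintro τ ⟨h, s, hs, -, rfl⟩
      refine ⟨finSwap h (h * s), ?_, rfl⟩
      have : shufAction H h (finSwap 1 s) = finSwap h (h * s) := by
        rw [shufAction_finSwap, mul_one]
      rw [SetLike.mem_coe, Subgroup.mem_comap, ← this, SemidirectProduct.inl_aut]
      exact C.mul_mem (C.mul_mem (hr h) (Subgroup.subset_closure
        (Finset.mem_coe.2 (inl_mem_shufflerMoves hs)))) (hr h⁻¹)
    obtain ⟨τ, hτ, e⟩ := hle (closure_swap_eq S hS σ.2)
    rw [show σ = τ from Subtype.ext e.symm]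
    exact hτ
  rw [eq_top_iff]
  intro w _
  rw [← SemidirectProduct.inl_left_mul_inr_right w]
  exact C.mul_mem (hl _) (hr _)

theorem sum_outBoundary_fiberOver_le {α : Type*} (Ω : Finset (α × H)) (s : H) :
    ∑ σ ∈ Ω.image Prod.fst, outBoundary (fiberOver Ω σ) s ≤
      (Ω.filter fun w => (w.1, w.2 * s) ∉ Ω).card := by
  rw [Finset.card_eq_sum_card_fiberwise (f := Prod.fst) (t := Ω.image Prod.fst)
    fun w hw => Finset.mem_coe.2 (Finset.mem_image_of_mem _ (Finset.mem_filter.1 hw).1)]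
  refine Finset.sum_le_sum fun σ _ => ?_
  refine Finset.card_le_card_of_injOn (fun h => (σ, h)) (fun h hh => ?_)
    (fun a _ b _ e => (Prod.mk.inj e).2)
  simp only [Finset.coe_filter, Finset.mem_filter, Set.mem_ofPred_eq, mem_fiberOver] at hh ⊢
  exact ⟨hh, trivial⟩

/-- The coordinates of a lampshuffler element. -/
def shufflerCoord (w : Lampshuffler H) : Perm H × H := (w.left, w.right)

theorem shufflerCoord_injective : Function.Injective (shufflerCoord (H := H)) := fun w w' h => by
  simp only [shufflerCoord, Prod.mk.injEq] at h
  exact SemidirectProduct.ext (Subtype.ext h.1) h.2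

theorem card_filter_image_shufflerCoord (Ω : Finset (Lampshuffler H)) (t : Lampshuffler H)
    (m : Perm H × H → Perm H × H) (hm : ∀ w, m (shufflerCoord w) = shufflerCoord (w * t)) :
    ((Ω.image shufflerCoord).filter fun q => m q ∉ Ω.image shufflerCoord).card =
      outBoundary Ω t := by
  rw [Finset.filter_image, Finset.card_image_of_injective _ shufflerCoord_injective, outBoundary]
  simp only [hm, Finset.mem_image, shufflerCoord_injective.eq_iff, exists_eq_right]

/-- A finite subset of the lampshuffler group with small boundary is exponentially large. -/
theorem pow_le_card_of_outBoundary (S : Finset H) {B : Finset H} (hB : B.Nonempty) {L : ℝ}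
    (hL : 1 ≤ L) {j : ℝ≥0} (hj : isoProfile S 1 L = j) {Ω : Finset (Lampshuffler H)}
    (hΩ : 16 * (S.card + 1) * (j : ℝ) *
      ∑ t ∈ shufflerMoves S B, (outBoundary Ω t : ℝ) < Ω.card)
    (k : ℕ) (hk : (k : ℝ) ≤ L / 16 + 1) : ((B.card : ℝ) / 8) ^ k ≤ Ω.card := by
  have hjt : isoProfile S 1 L ≠ ⊤ := by simp [hj]
  have hiso : ∀ F : Finset H, (F.card : ℝ) ≤ L →
      (F.card : ℝ) ≤ j * (2 * ∑ s ∈ S, (outBoundary F s : ℝ)) := fun F hF => by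
    have := card_le_isoProfile_mul S hjt F hF
    rw [hj] at this
    exact_mod_cast this
  set P := ∑ t ∈ shufflerMoves S B, (outBoundary Ω t : ℝ) with hP
  have hP0 : 0 ≤ P := Finset.sum_nonneg fun _ _ => Nat.cast_nonneg _
  have hPS : ∑ s ∈ S, (outBoundary Ω (SemidirectProduct.inr s) : ℝ) ≤ P := by
    rw [← Finset.sum_image (f := fun t => (outBoundary Ω t : ℝ))
      (SemidirectProduct.inr_injective.injOn)]
    exact Finset.sum_le_sum_of_subset_of_nonneg Finset.subset_union_left
      fun _ _ _ => Nat.cast_nonneg _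
  have hPB : ∑ b ∈ B, (outBoundary Ω (SemidirectProduct.inl (finSwap 1 b)) : ℝ) ≤ P := by
    rw [← Finset.sum_image (f := fun t => (outBoundary Ω t : ℝ)) (inl_finSwap_injective.injOn)]
    exact Finset.sum_le_sum_of_subset_of_nonneg Finset.subset_union_right
      fun _ _ _ => Nat.cast_nonneg _
  -- A single point has size `1 ≤ L` and boundary at most `S.card`. This lower bound on `j` lets the
  -- hypothesis on `Ω` control swaps too.
  have hj1 : 1 ≤ 2 * j * (S.card : ℝ) := by
    have h1 := hiso {1} (by simpa using hL)
    have h2 : ∑ s ∈ S, (outBoundary ({1} : Finset H) s : ℝ) ≤ ∑ s ∈ S, (1 : ℝ) :=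
      Finset.sum_le_sum fun s _ => by exact_mod_cast outBoundary_le_card {1} s
    simp only [Finset.sum_const, nsmul_eq_mul, mul_one, Finset.card_singleton, Nat.cast_one]
      at h1 h2
    nlinarith [j.2, mul_le_mul_of_nonneg_left h2 j.2]
  set Ω' := Ω.image shufflerCoord with hΩ'
  have hcard : Ω'.card = Ω.card := Finset.card_image_of_injective _ shufflerCoord_injective
  have hj0 : (0 : ℝ) ≤ j := j.2
  rw [← hcard]
  have hΩne : Ω'.Nonempty := by
    rw [← Finset.card_pos, hcard]
    have : (0 : ℝ) < Ω.card := lt_of_le_of_lt (by positivity) hΩ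
    exact_mod_cast this
  have hB1 : (1 : ℝ) ≤ B.card := by exact_mod_cast hB.card_pos
  refine pow_le_card_of_fibers hB hΩne ?_ ?_ k hk
  · have h1 : (((Ω'.filter fun w => ((fiberOver Ω' w.1).card : ℝ) ≤ L).card : ℕ) : ℝ) ≤
        ∑ σ ∈ Ω'.image Prod.fst, j * (2 * ∑ s ∈ S, (outBoundary (fiberOver Ω' σ) s : ℝ)) := by
      rw [Finset.card_eq_sum_card_fiberwise (f := Prod.fst) (t := Ω'.image Prod.fst)
        fun w hw => Finset.mem_coe.2 (Finset.mem_image_of_mem _ (Finset.mem_filter.1 hw).1)]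
      push_cast
      refine Finset.sum_le_sum fun σ _ => ?_
      by_cases hσ : ((fiberOver Ω' σ).card : ℝ) ≤ L
      · refine le_trans ?_ (hiso _ hσ)
        rw [card_fiberOver]
        exact_mod_cast Finset.card_le_card (Finset.filter_subset_filter _
          (Finset.filter_subset _ _))
      · rw [Finset.filter_filter, Finset.filter_false_of_mem]
        · simp only [Finset.card_empty, Nat.cast_zero]; positivity
        · rintro w - ⟨h, rfl⟩
          exact hσ h
    have h2 : ∑ σ ∈ Ω'.image Prod.fst, (j : ℝ) *
        (2 * ∑ s ∈ S, (outBoundary (fiberOver Ω' σ) s : ℝ)) ≤ j * (2 * P) := by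
      rw [← Finset.mul_sum, ← Finset.mul_sum, Finset.sum_comm]
      gcongr
      refine le_trans (Finset.sum_le_sum fun s _ => ?_) hPS
      rw [← card_filter_image_shufflerCoord Ω (SemidirectProduct.inr s)
        (fun q => (q.1, q.2 * s)) fun w => by rw [mul_inr]; rfl]
      exact_mod_cast sum_outBoundary_fiberOver_le Ω' s
    have h3 : (8 * (Ω'.filter fun w => ((fiberOver Ω' w.1).card : ℝ) ≤ L).card : ℝ) ≤
        Ω'.card := by
      rw [hcard]
      have h4 : 0 ≤ (S.card : ℝ) * (j * P) := by positivity
      nlinarith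
    exact_mod_cast h3
  · have h1 : ((((Ω' ×ˢ B).filter fun q => swapStep q.1 q.2 ∉ Ω').card : ℕ) : ℝ) ≤ P := by
      refine le_trans (le_of_eq ?_) hPB
      simp only [Finset.card_filter, Finset.sum_product_right]
      push_cast
      refine Finset.sum_congr rfl fun b _ => ?_
      rw [← card_filter_image_shufflerCoord Ω (SemidirectProduct.inl (finSwap 1 b))
        (fun q => swapStep q b) fun w => by rw [mul_inl_finSwap]; rfl, Finset.card_filter]
      push_cast
      rfl
    have h3 : (8 * ((Ω' ×ˢ B).filter fun q => swapStep q.1 q.2 ∉ Ω').card : ℝ) ≤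
        B.card * Ω'.card := by
      rw [hcard]
      have h4 : 0 ≤ (j : ℝ) * P := by positivity
      have h5 : P ≤ 2 * j * S.card * P := le_mul_of_one_le_left hP0 hj1
      have h6 : (Ω.card : ℝ) ≤ B.card * Ω.card := le_mul_of_one_le_left (by positivity) hB1
      nlinarith
    exact_mod_cast h3

/-- The moves need not generate: a generating set has profile at most a constant times that of any
finite set. Hence `B` can be chosen for its size alone. -/
theorem exists_isoProfile_shufflerMoves_le [Infinite H] (S : Finset H) :
    ∃ T : Finset (Lampshuffler H), ∃ K : ℝ≥0, 0 < K ∧ ∀ x : ℝ, Real.exp 1 ≤ x →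
      isoProfile T 1 x ≤ K * isoProfile S 1 (Real.log x) := by
  obtain ⟨B, hBcard⟩ := Infinite.exists_subset_card_eq H (8 * ⌈Real.exp 16⌉₊)
  have hexp : Real.exp 16 ≤ (B.card : ℝ) / 8 := by
    rw [hBcard]
    push_cast
    have := Nat.le_ceil (Real.exp 16)
    linarith
  have hB : B.Nonempty := by
    rw [← Finset.card_pos]
    have : (0 : ℝ) < B.card := by
      have := Real.exp_pos 16
      linarith
    exact_mod_cast this
  refine ⟨shufflerMoves S B, 16 * (S.card + 1), by positivity, fun x hx => ?_⟩
  have hx0 : 0 < x := lt_of_lt_of_le (Real.exp_pos 1) hx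
  have hL : 1 ≤ Real.log x := (Real.le_log_iff_exp_le hx0).2 hx
  by_cases hJ : isoProfile S 1 (Real.log x) = ⊤
  · rw [hJ, ENNReal.mul_top]
    · exact le_top
    · have : (0 : ℝ≥0) < 16 * (S.card + 1) := by positivity
      exact_mod_cast this.ne'
  obtain ⟨j, hj⟩ : ∃ j : ℝ≥0, (j : ℝ≥0∞) = isoProfile S 1 (Real.log x) :=
    ⟨_, ENNReal.coe_toNNReal hJ⟩
  refine isoProfile_one_le_of_forall_card_le _ fun Ω hΩ => ?_
  by_contra hlt
  rw [not_le, ← hj] at hlt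
  have hlt' : 16 * (S.card + 1) * (j : ℝ) *
      ∑ t ∈ shufflerMoves S B, (outBoundary Ω t : ℝ) < Ω.card := by
    have h0 : ((16 * (S.card + 1) * j * ∑ t ∈ shufflerMoves S B, (outBoundary Ω t : ℝ≥0) : ℝ≥0) :
        ℝ≥0∞) < ((Ω.card : ℝ≥0) : ℝ≥0∞) := by
      push_cast at hlt ⊢
      exact hlt
    exact_mod_cast ENNReal.coe_lt_coe.1 h0
  -- The least integer above `log x / 16`, so that `exp (16 * k) > x`, and still within the range
  -- allowed for freezing.
  set k := ⌊Real.log x / 16⌋₊ + 1 with hk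
  have hk1 : (k : ℝ) ≤ Real.log x / 16 + 1 := by
    rw [hk]; push_cast
    have := Nat.floor_le (show 0 ≤ Real.log x / 16 by positivity)
    linarith
  have hk2 : Real.log x / 16 < k := by
    rw [hk]; push_cast
    exact Nat.lt_floor_add_one _
  have h1 := pow_le_card_of_outBoundary S hB hL hj.symm hlt' k hk1
  have h2 : x < ((B.card : ℝ) / 8) ^ k := by
    refine lt_of_lt_of_le ?_ (pow_le_pow_left₀ (Real.exp_pos 16).le hexp k)
    rw [← Real.exp_nat_mul, ← Real.log_lt_iff_lt_exp hx0]
    linarith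
  linarith

end Lampshuffler

/-! ### Test functions for the lower bound, and finite groups. -/

section LowerBound

open Equiv

open scoped Classical

variable {H : Type*} [Group H]

/-- The finitely supported permutations supported in `F`. -/
noncomputable def permsSupportedIn {X : Type*} (F : Finset X) : Finset (finSym X) :=
  Finset.univ.image fun π : Perm {x // x ∈ F} =>
    ⟨Perm.ofSubtype π, (Finset.finite_toSet F).subset fun x hx => by
      by_contra h
      exact hx (Perm.ofSubtype_apply_of_not_mem π h)⟩

theorem card_permsSupportedIn_le {X : Type*} (F : Finset X) :
    (permsSupportedIn F).card ≤ F.card.factorial := by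
  refine Finset.card_image_le.trans_eq ?_
  rw [Finset.card_univ, Fintype.card_perm, Fintype.card_coe]

theorem mem_permsSupportedIn {X : Type*} {F : Finset X} {σ : finSym X} :
    σ ∈ permsSupportedIn F ↔ ∀ x, (σ : Perm X) x ≠ x → x ∈ F := by
  simp only [permsSupportedIn, Finset.mem_image, Finset.mem_univ, true_and]
  constructor
  · rintro ⟨π, rfl⟩ x hx
    by_contra h
    exact hx (Perm.ofSubtype_apply_of_not_mem π h)
  · intro h
    have h1 : ∀ x, (σ : Perm X) x ∈ F ↔ x ∈ F := fun x => by
      by_cases hx : (σ : Perm X) x = x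
      · rw [hx]
      · exact iff_of_true (h _ fun e => hx ((σ : Perm X).injective e)) (h x hx)
    exact ⟨(σ : Perm X).subtypePerm h1, Subtype.ext (Perm.ofSubtype_subtypePerm h1 h)⟩

theorem one_mem_permsSupportedIn {X : Type*} (F : Finset X) : 1 ∈ permsSupportedIn F :=
  mem_permsSupportedIn.2 fun _ hx => absurd rfl hx

theorem mul_finSwap_mem_permsSupportedIn_iff {X : Type*} {F : Finset X} {a b : X} (ha : a ∈ F)
    (hb : b ∈ F) (σ : finSym X) :
    σ * finSwap a b ∈ permsSupportedIn F ↔ σ ∈ permsSupportedIn F := by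
  have key : ∀ τ : finSym X, τ ∈ permsSupportedIn F → τ * finSwap a b ∈ permsSupportedIn F := by
    intro τ hτ
    rw [mem_permsSupportedIn] at hτ ⊢
    intro x hx
    by_cases hxa : x = a
    · rwa [hxa]
    by_cases hxb : x = b
    · rwa [hxb]
    refine hτ x fun e => hx ?_
    change (τ : Perm X) (swap a b x) = x
    rw [swap_apply_of_ne_of_ne hxa hxb, e]
  refine ⟨fun h => ?_, key σ⟩
  have h2 : finSwap a b * finSwap a b = (1 : finSym X) := Subtype.ext (swap_mul_self a b)
  have := key _ h
  rwa [mul_assoc, h2, mul_one] at this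

theorem tsum_lampshuffler (φ : Lampshuffler H → ℝ≥0∞) :
    ∑' w, φ w = ∑' σ : finSym H, ∑' h : H, φ ⟨σ, h⟩ := by
  rw [← SemidirectProduct.equivProd.symm.tsum_eq φ, ENNReal.tsum_prod']
  rfl

theorem tsum_indicator_mul {α : Type*} [DecidableEq α] (P : Finset α) (c : ℝ≥0∞) :
    ∑' a, (if a ∈ P then c else 0) = P.card * c := by
  rw [tsum_eq_sum (s := P) fun a ha => if_neg ha, Finset.sum_congr rfl fun a ha => if_pos ha,
    Finset.sum_const, nsmul_eq_mul]

/-- The function `(σ, h) ↦ f h` for `σ` supported in the support of `f`, extended by zero. -/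
noncomputable def shuffledFunction (f : H →₀ ℝ≥0) : Lampshuffler H →₀ ℝ≥0 :=
  Finsupp.onFinset ((permsSupportedIn f.support ×ˢ f.support).image fun q => ⟨q.1, q.2⟩)
    (fun w => if w.left ∈ permsSupportedIn f.support then f w.right else 0) fun w hw => by
      have hw' : w.left ∈ permsSupportedIn f.support ∧ f w.right ≠ 0 := by simpa using hw
      exact Finset.mem_image.2 ⟨(w.left, w.right), Finset.mem_product.2
        ⟨hw'.1, Finsupp.mem_support_iff.2 hw'.2⟩, rfl⟩

theorem shuffledFunction_apply (f : H →₀ ℝ≥0) (w : Lampshuffler H) :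
    shuffledFunction f w = if w.left ∈ permsSupportedIn f.support then f w.right else 0 :=
  rfl

theorem shuffledFunction_ne_zero {f : H →₀ ℝ≥0} (hf : f ≠ 0) : shuffledFunction f ≠ 0 := by
  obtain ⟨h, hh⟩ := Finsupp.ne_iff.1 hf
  refine Finsupp.ne_iff.2 ⟨⟨1, h⟩, ?_⟩
  rw [shuffledFunction_apply, if_pos (one_mem_permsSupportedIn _)]
  exact hh

theorem card_support_shuffledFunction_le (f : H →₀ ℝ≥0) :
    (shuffledFunction f).support.card ≤ f.support.card.factorial * f.support.card := by
  refine (Finset.card_le_card Finsupp.support_onFinset_subset).trans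
    (Finset.card_image_le.trans ?_)
  rw [Finset.card_product]
  exact Nat.mul_le_mul_right _ (card_permsSupportedIn_le _)

theorem lpNormFin_shuffledFunction {p : ℝ} (hp : 1 ≤ p) (f : H →₀ ℝ≥0) :
    lpNormFin p (shuffledFunction f) =
      ((permsSupportedIn f.support).card : ℝ≥0∞) ^ (1 / p) * lpNormFin p f := by
  have hp0 : 0 < p := by linarith
  unfold lpNormFin
  rw [← ENNReal.mul_rpow_of_nonneg _ _ (by positivity), ← tsum_indicator_mul, tsum_lampshuffler]
  congr 1
  refine tsum_congr fun σ => ?_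
  simp only [shuffledFunction_apply]
  split_ifs
  · rfl
  · simp [hp0]

theorem translationDefect_shuffledFunction_inr {p : ℝ} (hp : 1 ≤ p) (f : H →₀ ℝ≥0) (s : H) :
    translationDefect p (shuffledFunction f) (SemidirectProduct.inr s) =
      (permsSupportedIn f.support).card * translationDefect p f s := by
  have hp0 : 0 < p := by linarith
  rw [← tsum_indicator_mul, translationDefect, tsum_lampshuffler]
  refine tsum_congr fun σ => ?_
  simp only [shuffledFunction_apply, mul_inr]
  split_ifs
  · rfl
  · simp [hp0]

/-- The move keeps `h`, so the value changes only if exactly one of `σ` and the swapped permutation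
is supported in the support of `f`. If `f h ≠ 0`, this forces `f (h * s) = 0`, and the change is the
variation of `f` itself. Either permutation may be the admissible one, hence the factor `2`. -/
theorem translationDefect_shuffledFunction_inl_le {p : ℝ} (hp : 1 ≤ p) (f : H →₀ ℝ≥0) (s : H) :
    translationDefect p (shuffledFunction f) (SemidirectProduct.inl (finSwap 1 s)) ≤
      2 * (permsSupportedIn f.support).card * translationDefect p f s := by
  have hp0 : 0 < p := by linarith
  rw [translationDefect, tsum_lampshuffler, ENNReal.tsum_comm, translationDefect,
    ← ENNReal.tsum_mul_left]
  refine ENNReal.tsum_le_tsum fun h => ?_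
  set c := ENNReal.ofReal |(f h : ℝ) - (f (h * s) : ℝ)| ^ p with hc
  set P := permsSupportedIn f.support with hP
  have hshift : ∑' σ : finSym H, (if σ * finSwap h (h * s) ∈ P then c else 0) = P.card * c := by
    rw [← tsum_indicator_mul]
    exact (Equiv.mulRight (finSwap h (h * s))).tsum_eq fun σ => if σ ∈ P then c else 0
  rw [two_mul, add_mul]
  nth_rewrite 1 [← tsum_indicator_mul]
  rw [← hshift, ← ENNReal.tsum_add]
  refine ENNReal.tsum_le_tsum fun σ => ?_
  simp only [shuffledFunction_apply, mul_inl_finSwap, ← hP]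
  by_cases h1 : h ∈ f.support
  · by_cases h2 : h * s ∈ f.support
    · simp only [hP, mul_finSwap_mem_permsSupportedIn_iff h1 h2]
      simp [hp0]
    · have hfs : f (h * s) = 0 := Finsupp.notMem_support_iff.1 h2
      rw [hfs] at hc
      by_cases h3 : σ ∈ P <;> by_cases h4 : σ * finSwap h (h * s) ∈ P <;>
        simp [h3, h4, hc, hp0]
  · have hf0 : f h = 0 := Finsupp.notMem_support_iff.1 h1
    simp [hf0, hp0]

theorem sum_translationDefect_shuffledFunction_le {p : ℝ} (hp : 1 ≤ p) (f : H →₀ ℝ≥0)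
    (S : Finset H) :
    ∑ t ∈ shufflerMoves S S, translationDefect p (shuffledFunction f) t ≤
      3 * (permsSupportedIn f.support).card * ∑ s ∈ S, translationDefect p f s := by
  -- Translation and swap moves may coincide, so the sum over the union is only bounded by the two
  -- separate sums.
  refine le_trans (le_trans le_self_add (Finset.sum_union_inter (f := fun t =>
    translationDefect p (shuffledFunction f) t)).le) ?_
  rw [Finset.sum_image SemidirectProduct.inr_injective.injOn,
    Finset.sum_image inl_finSwap_injective.injOn, ← Finset.sum_add_distrib, Finset.mul_sum]
  refine Finset.sum_le_sum fun s _ => ?_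
  rw [translationDefect_shuffledFunction_inr hp]
  refine (add_le_add_right (translationDefect_shuffledFunction_inl_le hp f s) _).trans_eq ?_
  ring

theorem isoProfile_le_shufflerMoves {p : ℝ} (hp : 1 ≤ p) (S : Finset H) {x y : ℝ}
    (hxy : ∀ n : ℕ, 1 ≤ n → (n : ℝ) ≤ y → ((n.factorial * n : ℕ) : ℝ) ≤ x) :
    isoProfile S p y ≤ (3 : ℝ≥0∞) ^ (1 / p) * isoProfile (shufflerMoves S S) p x := by
  have hp0 : 0 ≤ 1 / p := by positivity
  refine isoProfile_le fun f hf hy => ?_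
  have hP : ((permsSupportedIn f.support).card : ℝ≥0∞) ≠ 0 := by
    exact_mod_cast (Finset.card_pos.2 ⟨1, one_mem_permsSupportedIn _⟩).ne'
  set m : ℝ≥0∞ := ((permsSupportedIn f.support).card : ℝ≥0∞) ^ (1 / p) with hm
  have hm0 : m ≠ 0 := (ENNReal.rpow_pos (pos_iff_ne_zero.2 hP) (by simp)).ne'
  have hmt : m ≠ ⊤ := ENNReal.rpow_ne_top_of_nonneg hp0 (by simp)
  have hgrad : lpNormGrad (shufflerMoves S S) p (shuffledFunction f) ≤
      3 ^ (1 / p) * (m * lpNormGrad S p f) := by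
    have := lpNormGrad_le_of_sum_le hp (sum_translationDefect_shuffledFunction_le hp f S)
    rwa [ENNReal.mul_rpow_of_nonneg _ _ hp0, mul_assoc] at this
  have hcard : 1 ≤ f.support.card :=
    Finset.card_pos.2 (Finsupp.support_nonempty_iff.2 hf)
  have hsupp : ((shuffledFunction f).support.card : ℝ) ≤ x :=
    le_trans (by exact_mod_cast card_support_shuffledFunction_le f) (hxy _ hcard hy)
  rw [← ENNReal.mul_div_mul_left _ _ hm0 hmt, hm, ← lpNormFin_shuffledFunction hp]
  refine (ENNReal.div_le_mul_div_of_le_mul ?_ ?_ hgrad).trans ?_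
  · exact (ENNReal.rpow_pos (by norm_num) (by simp)).ne'
  · exact ENNReal.rpow_ne_top_of_nonneg hp0 (by simp)
  · gcongr
    exact le_isoProfile _ p (shuffledFunction_ne_zero hf) hsupp

theorem factorial_mul_self_le_pow {n : ℕ} (hn : 1 ≤ n) : n.factorial * n ≤ n ^ n := by
  induction n, hn using Nat.le_induction with
  | base => simp
  | succ n hn ih =>
    obtain ⟨k, rfl⟩ : ∃ k, n = k + 1 := ⟨n - 1, by omega⟩
    have h1 : (k + 1).factorial ≤ (k + 1) ^ k :=
      Nat.le_of_mul_le_mul_right (by rwa [← pow_succ]) (Nat.succ_pos k)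
    have h2 : (k + 1) ^ k ≤ (k + 1 + 1) ^ k := Nat.pow_le_pow_left (Nat.le_succ _) _
    calc (k + 1 + 1).factorial * (k + 1 + 1) = (k + 1).factorial * (k + 1 + 1) ^ 2 := by
          rw [Nat.factorial_succ (k + 1)]; ring
      _ ≤ (k + 1 + 1) ^ k * (k + 1 + 1) ^ 2 := Nat.mul_le_mul_right _ (h1.trans h2)
      _ = _ := by rw [← pow_add]

/-- Past `exp (exp 1)` the denominator is at least `1`, so `log n ≤ log (log x)` and `n * log n ≤
log x`. -/
theorem factorial_mul_self_le_of_le_log_div {x : ℝ} (hx : Real.exp (Real.exp 1) ≤ x) {n : ℕ}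
    (hn : 1 ≤ n) (hnx : (n : ℝ) ≤ Real.log x / Real.log (Real.log x)) :
    ((n.factorial * n : ℕ) : ℝ) ≤ x := by
  have hx0 : 0 < x := lt_of_lt_of_le (Real.exp_pos _) hx
  have hu : Real.exp 1 ≤ Real.log x := (Real.le_log_iff_exp_le hx0).2 hx
  have hu0 : 0 < Real.log x := lt_of_lt_of_le (Real.exp_pos _) hu
  have hw : 1 ≤ Real.log (Real.log x) := (Real.le_log_iff_exp_le hu0).2 hu
  have hn0 : (0 : ℝ) < n := by exact_mod_cast hn
  have hlog : Real.log n ≤ Real.log (Real.log x) :=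
    Real.log_le_log hn0 (hnx.trans (div_le_self hu0.le hw))
  have hmul : n * Real.log n ≤ Real.log x :=
    (mul_le_mul_of_nonneg_left hlog hn0.le).trans ((le_div_iff₀ (by linarith)).1 hnx)
  refine le_trans (Nat.cast_le.2 (factorial_mul_self_le_pow hn)) ?_
  rw [Nat.cast_pow]
  rwa [← Real.log_le_log_iff (by positivity) hx0, Real.log_pow]

theorem isoProfile_eq_top_of_finite [Finite H] (S : Finset H) {x : ℝ}
    (hx : (Nat.card H : ℝ) ≤ x) : isoProfile S 1 x = ⊤ := by
  have := Fintype.ofFinite H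
  set f : H →₀ ℝ≥0 := Finsupp.equivFunOnFinite.symm fun _ => 1 with hf
  have hfg : ∀ g, f g = 1 := fun _ => rfl
  have hf0 : f ≠ 0 := Finsupp.ne_iff.2 ⟨1, by simp [hfg]⟩
  have hcard : (f.support.card : ℝ) ≤ x := by
    refine le_trans ?_ hx
    rw [Nat.card_eq_fintype_card]
    exact_mod_cast Finset.card_le_univ _
  have h := le_isoProfile S 1 hf0 hcard
  have hG : lpNormGrad S 1 f = 0 := by simp [lpNormGrad, hfg]
  have hN : lpNormFin 1 f ≠ 0 := by
    have := tsum_rpow_ne_zero le_rfl hf0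
    simpa [lpNormFin] using this
  rw [hG, ENNReal.div_zero hN] at h
  exact top_le_iff.1 h

end LowerBound

/-! ### The two bounds for an arbitrary generating set. -/

theorem theoremA {H : Type*} [Group H] (hH : IsAmenableGroup H)
    (S : Finset H) (hS : Subgroup.closure (S : Set H) = ⊤)
    (p : ℝ) (hp : 1 ≤ p) (hstar : AssumptionStar (isoProfile S p)) :
    Group.FG (Lampshuffler H) ∧
    ∀ T : Finset (Lampshuffler H), Subgroup.closure (T : Set (Lampshuffler H)) = ⊤ →
      Dominated (fun x => isoProfile S p (Real.log x / Real.log (Real.log x))) (isoProfile T p) ∧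
      Dominated (isoProfile T p) (fun x => isoProfile S 1 (Real.log x)) := by
  refine ⟨Group.fg_iff.2 ⟨_, closure_shufflerMoves S hS, Finset.finite_toSet _⟩, fun T hT =>
    ⟨⟨1, one_pos, ?_⟩, ⟨1, one_pos, ?_⟩⟩⟩
  · obtain ⟨C, hC0, hC⟩ := exists_isoProfile_le_of_closure_eq_top hp (shufflerMoves S S) T
      (closure_shufflerMoves S hS)
    refine ⟨3 ^ (1 / p) * C, mul_pos (NNReal.rpow_pos (by norm_num)) hC0, ?_⟩
    filter_upwards [Filter.eventually_ge_atTop (Real.exp (Real.exp 1))] with x hx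
    rw [one_mul]
    refine (isoProfile_le_shufflerMoves hp S (x := x) fun n hn hnx =>
      factorial_mul_self_le_of_le_log_div hx hn hnx).trans ?_
    rw [ENNReal.coe_mul, ENNReal.coe_rpow_of_nonneg _ (by positivity), mul_assoc]
    gcongr
    · simp
    · exact hC x
  · simp only [one_mul]
    rcases finite_or_infinite H with hfin | hinf
    -- Over a finite group constants have zero gradient, so the right-hand side is eventually
    -- infinite.
    · refine ⟨1, one_pos, ?_⟩
      filter_upwards [Real.tendsto_log_atTop.eventually_ge_atTop (Nat.card H : ℝ)] with x hx
      rw [isoProfile_eq_top_of_finite S hx]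
      simp
    · obtain ⟨U, K, hK0, hK⟩ := exists_isoProfile_shufflerMoves_le S
      obtain ⟨C, hC0, hC⟩ := exists_isoProfile_le_one hp T
      obtain ⟨D, hD0, hD⟩ := exists_isoProfile_le_of_closure_eq_top le_rfl T U hT
      refine ⟨C * (D * K), by positivity, ?_⟩
      filter_upwards [Filter.eventually_ge_atTop (Real.exp 1)] with x hx
      refine (hC x).trans ?_
      rw [ENNReal.coe_mul, ENNReal.coe_mul, mul_assoc, mul_assoc]
      gcongr
      exact (hD x).trans (by gcongr; exact hK x hx)
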